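/- Let $n\ge 2$ and let $\mathbb R^n$ carry the Minkowski metric $\eta=\mathrm{diag}(-1,1,\dots,1)$, with $x^0$ the time coordinate; indices are raised and lowered with $\eta$, and $\square=\eta^{ab}\partial_a\partial_b$. A subset $A\subseteq\mathbb R^n$ is past-compact if $A\cap J^-(x)$ is compact for every $x\in\mathbb R^n$, where $J^\pm$ denotes the causal future/past. Let $C^\infty_{\mathrm{pc}}(\mathbb R^n)$ be the space of smooth real functions with past-compact support; a tensor field is called smooth and past-compact if all its Cartesian components lie in $C^\infty_{\mathrm{pc}}(\mathbb R^n)$. There is a unique retarded Green operator of $\square$, i.e. a unique linear operator $\mathsf G_{\mathrm{ret}}\colon C^\infty_{\mathrm{pc}}(\mathbb R^n)\to C^\infty_{\mathrm{pc}}(\mathbb R^n)$ with $\square\,\mathsf G_{\mathrm{ret}}f=f$, $\mathsf G_{\mathrm{ret}}\square f=f$ and $\operatorname{supp}(\mathsf G_{\mathrm{ret}}f)\subseteq J^+(\operatorname{supp} f)$ for all $f\in C^\infty_{\mathrm{pc}}(\mathbb R^n)$ (it acts on tensor fields componentwise). Moreover, for every smooth past-compact symmetric $(0,2)$-tensor field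 $h_{ab}$ on $\mathbb R^n$, with trace $h:=\eta^{ab}h_{ab}$, there are unique smooth past-compact fields: a scalar $w$, a covector field $v^{\mathrm T}_a$ with $\partial^a v^{\mathrm T}_a=0$, and a symmetric $(0,2)$-tensor field $h^{\mathrm{TT}}_{ab}$ with $\partial^a h^{\mathrm{TT}}_{ab}=0$ and $\eta^{ab}h^{\mathrm{TT}}_{ab}=0$, such that $$h_{ab}=h^{\mathrm S}_{ab}+h^{\mathrm V}_{ab}+h^{\mathrm{TT}}_{ab},$$ where $$h^{\mathrm S}_{ab}:=\Big(\partial_a\partial_b-\frac1n\eta_{ab}\square\Big)w+\frac1n\eta_{ab}h,\qquad h^{\mathrm V}_{ab}:=\partial_a v^{\mathrm T}_b+\partial_b v^{\mathrm T}_a .$$ These fields are given by $$w=\frac{n}{n-1}\,\mathsf G_{\mathrm{ret}}\,\mathsf G_{\mathrm{ret}}\Big(\partial^a\partial^b h_{ab}-\frac1n\square h\Big),\qquad v^{\mathrm T}_b=\mathsf G_{\mathrm{ret}}\Big(\partial^a h_{ab}-\frac1n\partial_b h-\frac{n-1}{n}\,\partial_b\square w\Big).$$ -/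

import Mathlib

open scoped ContDiff

noncomputable section

namespace Minkowski

/-- The manifold `ℝⁿ`; coordinate `0` is the time coordinate. -/
abbrev Spacetime (n : ℕ) := EuclideanSpace ℝ (Fin n)

/-- The Minkowski metric `diag(-1, 1, …, 1)`. It is its own inverse (`eta_mul_eta`), so the same
matrix is used for `η_{ab}` and for `η^{ab}`. -/
def eta (n : ℕ) : Matrix (Fin n) (Fin n) ℝ :=
  Matrix.diagonal fun a => if (a : ℕ) = 0 then -1 else 1

theorem eta_mul_eta (n : ℕ) : eta n * eta n = 1 := by
  unfold eta
  rw [Matrix.diagonal_mul_diagonal, ← Matrix.diagonal_one]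
  congr 1
  funext a
  split_ifs <;> norm_num

/-- The closed forward light cone: causal vectors `z` (that is `η(z, z) ≤ 0`) with `z⁰ ≥ 0`. -/
def forwardCone (n : ℕ) : Set (Spacetime n) :=
  {z | (∑ a, ∑ b, eta n a b * z a * z b) ≤ 0 ∧ ∀ a : Fin n, (a : ℕ) = 0 → 0 ≤ z a}

/-- The causal future `J⁺(A)`. -/
def causalFuture {n : ℕ} (A : Set (Spacetime n)) : Set (Spacetime n) :=
  {x | ∃ y ∈ A, x - y ∈ forwardCone n}

/-- The causal past `J⁻(x)` of a point. -/
def causalPast {n : ℕ} (x : Spacetime n) : Set (Spacetime n) :=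
  {y | x - y ∈ forwardCone n}

/-- `A` is past-compact if `A ∩ J⁻(x)` is compact for every point `x`. -/
def IsPastCompact {n : ℕ} (A : Set (Spacetime n)) : Prop :=
  ∀ x : Spacetime n, IsCompact (A ∩ causalPast x)

theorem IsPastCompact.union {n : ℕ} {A B : Set (Spacetime n)} (hA : IsPastCompact A)
    (hB : IsPastCompact B) : IsPastCompact (A ∪ B) := by
  intro x
  rw [Set.union_inter_distrib_right]
  exact (hA x).union (hB x)

theorem IsPastCompact.mono {n : ℕ} {A B : Set (Spacetime n)} (hA : IsPastCompact A)
    (hB : IsClosed B) (h : B ⊆ A) : IsPastCompact B := by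
  intro x
  have e : B ∩ causalPast x = (A ∩ causalPast x) ∩ B := by
    ext y
    exact ⟨fun hy => ⟨⟨h hy.1, hy.2⟩, hy.1⟩, fun hy => ⟨hy.2, hy.1.2⟩⟩
  rw [e]
  exact (hA x).inter_right hB

/-- `C^∞_pc(ℝⁿ)`: smooth real functions with past-compact support. -/
def SmoothPC (n : ℕ) : Submodule ℝ (Spacetime n → ℝ) where
  carrier := {f | ContDiff ℝ ∞ f ∧ IsPastCompact (tsupport f)}
  add_mem' {f g} hf hg :=
    ⟨hf.1.add hg.1, (hf.2.union hg.2).mono (isClosed_tsupport _) (tsupport_add f g)⟩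
  zero_mem' := ⟨contDiff_const, fun x => by simp [tsupport]⟩
  smul_mem' c f hf :=
    ⟨contDiff_const.smul hf.1,
      hf.2.mono (isClosed_tsupport _) (tsupport_smul_subset_right (fun _ => c) f)⟩

/-- The partial derivative `∂_a` on `C^∞_pc(ℝⁿ)`. -/
def pd {n : ℕ} (a : Fin n) : SmoothPC n →ₗ[ℝ] SmoothPC n where
  toFun f := ⟨fun x => fderiv ℝ f.1 x (EuclideanSpace.single a 1),
    (f.2.1.fderiv_right (m := ∞) le_rfl).clm_apply contDiff_const,
    f.2.2.mono (isClosed_tsupport _) (tsupport_fderiv_apply_subset ℝ _)⟩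
  map_add' f g := by
    ext x
    have hf : DifferentiableAt ℝ f.1 x := f.2.1.contDiffAt.differentiableAt (by simp)
    have hg : DifferentiableAt ℝ g.1 x := g.2.1.contDiffAt.differentiableAt (by simp)
    change fderiv ℝ (f.1 + g.1) x _ = fderiv ℝ f.1 x _ + fderiv ℝ g.1 x _
    rw [fderiv_add hf hg]
    rfl
  map_smul' c f := by
    ext x
    have hf : DifferentiableAt ℝ f.1 x := f.2.1.contDiffAt.differentiableAt (by simp)
    change fderiv ℝ (c • f.1) x _ = c • fderiv ℝ f.1 x _
    rw [fderiv_const_smul hf]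
    rfl

/-- The d'Alembert operator `□ = η^{ab} ∂_a ∂_b`. -/
def box {n : ℕ} : SmoothPC n →ₗ[ℝ] SmoothPC n :=
  ∑ a, ∑ b, eta n a b • (pd a ∘ₗ pd b)

/-- The retarded Green operator of `□`: the linear operator `G` on `C^∞_pc(ℝⁿ)` with
`□ G f = f`, `G □ f = f` and `supp (G f) ⊆ J⁺(supp f)`. -/
structure IsRetardedGreenOperator {n : ℕ} (G : SmoothPC n →ₗ[ℝ] SmoothPC n) : Prop where
  box_apply : ∀ f, box (G f) = f
  apply_box : ∀ f, G (box f) = f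
  support_subset : ∀ f, tsupport (G f).1 ⊆ causalFuture (tsupport f.1)

/-- Smooth past-compact `(0,1)`-tensor fields, given by their Cartesian components. -/
abbrev Covector (n : ℕ) := Fin n → SmoothPC n

/-- Smooth past-compact `(0,2)`-tensor fields, given by their Cartesian components. -/
abbrev Tensor2 (n : ℕ) := Matrix (Fin n) (Fin n) (SmoothPC n)

/-- `∂^a v_a`. -/
def divCovector {n : ℕ} (v : Covector n) : SmoothPC n :=
  ∑ a, ∑ c, eta n a c • pd c (v a)

/-- `(∂^a h_{ab})_b`. -/
def divTensor {n : ℕ} (h : Tensor2 n) : Covector n :=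
  fun b => ∑ a, ∑ c, eta n a c • pd c (h a b)

/-- The trace `η^{ab} h_{ab}`. -/
def trace {n : ℕ} (h : Tensor2 n) : SmoothPC n :=
  ∑ a, ∑ b, eta n a b • h a b

/-- `h^S_{ab} = (∂_a ∂_b - (1/n) η_{ab} □) w + (1/n) η_{ab} tr`; here `tr` is to be the trace of
the tensor that is decomposed. -/
def scalarPart {n : ℕ} (w tr : SmoothPC n) : Tensor2 n := fun a b =>
  (pd a (pd b w) - (1 / (n : ℝ)) • eta n a b • box w) + (1 / (n : ℝ)) • eta n a b • tr

/-- `h^V_{ab} = ∂_a v_b + ∂_b v_a`. -/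
def vectorPart {n : ℕ} (v : Covector n) : Tensor2 n := fun a b => pd a (v b) + pd b (v a)

/-- `h = h^S + h^V + h^TT` with `v` divergence-free and `hTT` symmetric, transverse and
traceless. -/
structure IsDecomposition {n : ℕ} (h : Tensor2 n) (w : SmoothPC n) (v : Covector n)
    (hTT : Tensor2 n) : Prop where
  div_v : divCovector v = 0
  symm_hTT : hTT.IsSymm
  div_hTT : divTensor hTT = 0
  trace_hTT : trace hTT = 0
  sum_eq : h = scalarPart w (trace h) + vectorPart v + hTT

end Minkowski

end

/-! Write `γ = -η` for the form `mform` and `n = m + 1`. The analytic core is an inverse of `□^n`,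
from which a Green operator of `□` follows by differentiation. The Riesz kernel `γ^{n/2}` on the
forward cone is Lorentz invariant and homogeneous of degree `n`, so its Laplace transform at a
future timelike `q` is a positive constant times `γ(q)^{-n}` (`rieszLaplace_of_timelike`). Up to
sign, `γ(q)^n` is the symbol of `□^n`, so convolution with the kernel should invert `□^n` up to a
nonzero constant `c`. Unlike the distributional fundamental solution of `□`, this kernel is a
continuous function, and ordinary convolution suffices.

To make this rigorous, the Laplace transform is continued analytically from real points near `e₀` to
`e₀ + i ℝ q` (`mul_complexMGF_rieszMeasure`). This gives the Fourier transform of the kernel damped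
by `exp (-z⁰)`. The multiplication formula and Fourier inversion then settle compact supports
(`rieszConv_box_pow_of_hasCompactSupport`). Since the convolution at `x` sees only `J⁻(x)`, cutting
off extends the result to past-compact supports (`rieszOp_box_pow`). Then `G = c⁻¹ □^{n-1} R`, with
`R` the convolution, is the retarded Green operator; it is unique because `□` is injective.

The decomposition is then algebra. One divergence of `h = h^S + h^V + h^TT` expresses `□ v_b`
through `h` and `w`, and a second expresses `□□w` through `h` alone. Injectivity of `□` gives
uniqueness, and applying `G` gives existence with the stated formulas. -/

noncomputable section

namespace Minkowski

open Filter Topology MeasureTheory ProbabilityTheory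
open scoped Pointwise FourierTransform SchwartzMap LineDeriv

/-! ### Geometry of the forward cone -/

/-- The bilinear form `x⁰ y⁰ - ∑ xⁱ yⁱ = -η(x, y)`. -/
def mform (m : ℕ) : Spacetime (m + 1) →ₗ[ℝ] Spacetime (m + 1) →ₗ[ℝ] ℝ :=
  LinearMap.mk₂ ℝ (fun x y => x 0 * y 0 - ∑ i : Fin m, x i.succ * y i.succ)
    (fun x y z => by simp [add_mul, Finset.sum_add_distrib]; ring)
    (fun c x y => by simp [mul_assoc, Finset.mul_sum, mul_sub])
    (fun x y z => by simp [mul_add, Finset.sum_add_distrib]; ring)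
    (fun c x y => by simp [mul_left_comm, Finset.mul_sum, mul_sub])

variable {m : ℕ}

theorem mform_apply (x y : Spacetime (m + 1)) :
    mform m x y = x 0 * y 0 - ∑ i : Fin m, x i.succ * y i.succ := rfl

theorem mform_comm (x y : Spacetime (m + 1)) : mform m x y = mform m y x := by
  simp [mform_apply, mul_comm]

/-- The unit vector in the time direction. -/
abbrev timeVec (m : ℕ) : Spacetime (m + 1) := EuclideanSpace.single 0 1

theorem mform_timeVec (x : Spacetime (m + 1)) : mform m x (timeVec m) = x 0 := by
  simp [mform_apply]

theorem timeVec_mform (x : Spacetime (m + 1)) : mform m (timeVec m) x = x 0 := by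
  rw [mform_comm, mform_timeVec]

theorem sum_eta_smul {M : Type*} [AddCommGroup M] [Module ℝ M]
    (F : Fin (m + 1) → Fin (m + 1) → M) :
    ∑ a, ∑ b, eta (m + 1) a b • F a b = -F 0 0 + ∑ i : Fin m, F i.succ i.succ := by
  have h (a : Fin (m + 1)) : ∑ b, eta (m + 1) a b • F a b
      = (if (a : ℕ) = 0 then -1 else 1 : ℝ) • F a a := by
    rw [Finset.sum_eq_single a]
    · simp [eta]
    · intro b _ hb
      simp [eta, Matrix.diagonal_apply_ne _ hb.symm]
    · simp
  simp [h, Fin.sum_univ_succ]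

theorem mem_forwardCone {z : Spacetime (m + 1)} :
    z ∈ forwardCone (m + 1) ↔ 0 ≤ mform m z z ∧ 0 ≤ z 0 := by
  have h1 : (∑ a, ∑ b, eta (m + 1) a b * z a * z b) = - mform m z z := by
    simp_rw [mul_assoc]
    rw [mform_apply]
    have h := sum_eta_smul fun a b => z a * z b
    simp only [smul_eq_mul] at h
    rw [h]
    ring
  have h2 : (∀ a : Fin (m + 1), (a : ℕ) = 0 → 0 ≤ z a) ↔ 0 ≤ z 0 := by
    constructor
    · intro h
      exact h 0 rfl
    · intro h a ha
      have : a = 0 := Fin.ext ha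
      rwa [this]
  simp [forwardCone, h1]

/-- Cauchy–Schwarz applies to the spatial parts, whose norms are dominated by the time components.
Convexity of the cone and preservation of time orientation by half-turns both rest on this. -/
theorem mform_nonneg {x y : Spacetime (m + 1)} (hx : x ∈ forwardCone (m + 1))
    (hy : y ∈ forwardCone (m + 1)) : 0 ≤ mform m x y := by
  rw [mem_forwardCone] at hx hy
  rw [mform_apply] at hx hy ⊢
  have h := Finset.sum_mul_sq_le_sq_mul_sq Finset.univ (fun i : Fin m => x i.succ)
    fun i => y i.succ
  have h1 : ∑ i : Fin m, x i.succ ^ 2 ≤ x 0 ^ 2 := by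
    simpa [sq] using hx.1
  have h2 : ∑ i : Fin m, y i.succ ^ 2 ≤ y 0 ^ 2 := by
    simpa [sq] using hy.1
  have h3 : (∑ i : Fin m, x i.succ * y i.succ) ^ 2 ≤ (x 0 * y 0) ^ 2 := by
    rw [mul_pow]
    exact h.trans (mul_le_mul h1 h2 (Finset.sum_nonneg fun _ _ => sq_nonneg _) (sq_nonneg _))
  have := abs_le_of_sq_le_sq' h3 (mul_nonneg hx.2 hy.2)
  linarith [this.2]

theorem zero_mem_forwardCone : (0 : Spacetime (m + 1)) ∈ forwardCone (m + 1) := by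
  simp [mem_forwardCone]

theorem add_mem_forwardCone {x y : Spacetime (m + 1)} (hx : x ∈ forwardCone (m + 1))
    (hy : y ∈ forwardCone (m + 1)) : x + y ∈ forwardCone (m + 1) := by
  have h := mform_nonneg hx hy
  have h' := mform_comm x y
  rw [mem_forwardCone] at *
  simp only [map_add, LinearMap.add_apply, PiLp.add_apply]
  constructor <;> linarith [hx.1, hx.2, hy.1, hy.2]

theorem continuous_mform_self : Continuous fun z : Spacetime (m + 1) => mform m z z := by
  simp only [mform_apply]
  fun_prop

theorem isClosed_forwardCone : IsClosed (forwardCone (m + 1)) := by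
  have : forwardCone (m + 1) = {z | 0 ≤ mform m z z} ∩ {z | 0 ≤ z 0} := by
    ext z
    exact mem_forwardCone
  rw [this]
  exact (isClosed_le continuous_const continuous_mform_self).inter
    (isClosed_le continuous_const (by fun_prop))

theorem norm_sq_eq (z : Spacetime (m + 1)) : ‖z‖ ^ 2 = 2 * z 0 ^ 2 - mform m z z := by
  rw [EuclideanSpace.real_norm_sq_eq, Fin.sum_univ_succ, mform_apply]
  simp only [sq]
  ring

/-- The time coordinate controls the whole vector on the cone. This makes pieces of the cone bounded
in time compact, and makes `exp (-z⁰)` an exponentially decaying weight. -/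
theorem norm_le_of_mem_forwardCone {z : Spacetime (m + 1)} (hz : z ∈ forwardCone (m + 1)) :
    ‖z‖ ≤ 2 * z 0 := by
  rw [mem_forwardCone] at hz
  apply le_of_sq_le_sq _ (by linarith [hz.2])
  rw [norm_sq_eq]
  nlinarith [sq_nonneg (z 0)]

theorem abs_coord_le_norm (z : Spacetime (m + 1)) (a : Fin (m + 1)) : |z a| ≤ ‖z‖ := by
  simpa using PiLp.norm_apply_le z a

theorem forwardCone_mem_nhds_timeVec : forwardCone (m + 1) ∈ 𝓝 (timeVec m) := by
  have h1 : ∀ᶠ z in 𝓝 (timeVec m), 0 < mform m z z :=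
    continuous_mform_self.continuousAt.eventually_const_lt (by simp [mform_timeVec])
  have h2 : ∀ᶠ z : Spacetime (m + 1) in 𝓝 (timeVec m), 0 < z 0 :=
    (show Continuous fun z : Spacetime (m + 1) => z 0 by fun_prop).continuousAt.eventually_const_lt
      (by simp)
  filter_upwards [h1, h2] with z hz1 hz2
  exact mem_forwardCone.2 ⟨hz1.le, hz2.le⟩

/-! ### Causal pasts and past-compact sets -/

theorem isClosed_causalPast (x : Spacetime (m + 1)) : IsClosed (causalPast x) :=
  isClosed_forwardCone.preimage (by fun_prop : Continuous fun y : Spacetime (m + 1) => x - y)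

/-- A slightly later point has `x` in the interior of its past, so local questions at `x` reduce to
data on a single causal past. -/
theorem causalPast_mem_nhds (x : Spacetime (m + 1)) : causalPast (x + timeVec m) ∈ 𝓝 x := by
  have hc : ContinuousAt (fun y : Spacetime (m + 1) => x + timeVec m - y) x := by fun_prop
  apply hc.preimage_mem_nhds
  simpa using forwardCone_mem_nhds_timeVec

theorem causalPast_trans {x y z : Spacetime (m + 1)} (hxy : x ∈ causalPast y)
    (hyz : y ∈ causalPast z) : x ∈ causalPast z := by
  have := add_mem_forwardCone hxy hyz
  simpa [causalPast] using this

/-- Only sources in `A ∩ J⁻(x)` matter. That compact set plus the closed cone is closed; it is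
bounded within `J⁻(x)` because the time component of the cone vector is bounded there. -/
theorem IsPastCompact.causalFuture {A : Set (Spacetime (m + 1))} (hA : IsPastCompact A) :
    IsPastCompact (causalFuture A) := by
  intro x
  have e : Minkowski.causalFuture A ∩ causalPast x
      = ((A ∩ causalPast x) + forwardCone (m + 1)) ∩ causalPast x := by
    ext y
    constructor
    · rintro ⟨⟨a, ha, hay⟩, hy⟩
      have hay' : a ∈ causalPast y := hay
      exact ⟨Set.mem_add.2 ⟨a, ⟨ha, causalPast_trans hay' hy⟩, y - a, hay, add_sub_cancel a y⟩, hy⟩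
    · rintro ⟨h, hy⟩
      obtain ⟨a, ha, c, hc, rfl⟩ := Set.mem_add.1 h
      refine ⟨⟨a, ha.1, ?_⟩, hy⟩
      rwa [add_sub_cancel_left]
  rw [e]
  refine Metric.isCompact_of_isClosed_isBounded
    ((isClosed_forwardCone.add_left_of_isCompact (hA x)).inter (isClosed_causalPast x)) ?_
  obtain ⟨R, hR⟩ := (hA x).isBounded.exists_norm_le
  refine isBounded_iff_forall_norm_le.2 ⟨R + 2 * (|x 0| + R), ?_⟩
  rintro _ ⟨h, hy⟩
  obtain ⟨a, ha, c, hc, rfl⟩ := Set.mem_add.1 h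
  have h1 := norm_le_of_mem_forwardCone hc
  have h2 := (mem_forwardCone.1 hy).2
  simp only [PiLp.sub_apply, PiLp.add_apply] at h2
  have h3 := hR a ha
  have h4 := neg_abs_le (a 0)
  have h5 := abs_coord_le_norm a 0
  have h6 := le_abs_self (x 0)
  have h7 := norm_add_le a c
  simp only at h7 ⊢
  linarith

theorem IsPastCompact.isClosed {A : Set (Spacetime (m + 1))} (hA : IsPastCompact A) :
    IsClosed A := by
  rw [← isOpen_compl_iff, isOpen_iff_mem_nhds]
  intro x hx
  have h := (hA (x + timeVec m)).isClosed.isOpen_compl.mem_nhds (x := x) fun h => hx h.1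
  filter_upwards [h, causalPast_mem_nhds x] with y hy hy' hyA
  exact hy ⟨hyA, hy'⟩

theorem isPastCompact_of_isCompact {A : Set (Spacetime (m + 1))} (hA : IsCompact A) :
    IsPastCompact A := fun x => hA.inter_right (isClosed_causalPast x)

/-- A smooth cutoff equal to `1` near the compact set `tsupport f ∩ J⁻(y)`. Retarded convolutions
and differential operators at points of `J⁻(y)` cannot distinguish `g` from `f`, which reduces
past-compact to compact supports. -/
theorem exists_hasCompactSupport_eventuallyEq (f : SmoothPC (m + 1)) (y : Spacetime (m + 1)) :
    ∃ g : SmoothPC (m + 1), HasCompactSupport g.1 ∧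
      ∀ x ∈ causalPast y, g.1 =ᶠ[𝓝 x] f.1 := by
  obtain ⟨U, hU, hAU, hUc⟩ := exists_isOpen_superset_and_isCompact_closure (f.2.2 y)
  obtain ⟨V, hV, hAV, hVU⟩ := normal_exists_closure_subset (f.2.2 y).isClosed hU hAU
  obtain ⟨χ, hχ, -, hχ0, hχ1⟩ := exists_contMDiff_zero_iff_one_iff_of_isClosed
    (modelWithCornersSelf ℝ (Spacetime (m + 1))) (n := ⊤) hU.isClosed_compl
    (isClosed_closure (s := V)) (by
      rw [Set.disjoint_left]
      exact fun x hx hx' => hx (hVU hx'))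
  have hχs : HasCompactSupport χ := by
    refine HasCompactSupport.of_support_subset_isCompact hUc fun x hx => subset_closure ?_
    by_contra hxU
    exact hx ((hχ0 x).1 hxU)
  have hs : HasCompactSupport fun x => χ x * f.1 x := hχs.mul_right
  refine ⟨⟨fun x => χ x * f.1 x, hχ.contDiff.mul f.2.1, isPastCompact_of_isCompact hs⟩, hs, ?_⟩
  intro x hx
  by_cases hxf : x ∈ tsupport f.1
  · filter_upwards [hV.mem_nhds (hAV ⟨hxf, hx⟩)] with z hz
    simp [(hχ1 z).1 (subset_closure hz)]
  · filter_upwards [(isClosed_tsupport f.1).isOpen_compl.mem_nhds hxf] with z hz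
    simp [image_eq_zero_of_notMem_tsupport hz]

/-! ### The Riesz kernel and its integrability -/

/-- The Riesz kernel `γ(z)^{n/2}` on the forward cone, where `γ(z) = -η(z, z)` and `n = m + 1`. -/
def rieszKernel (m : ℕ) : Spacetime (m + 1) → ℝ :=
  (forwardCone (m + 1)).indicator fun z => √(mform m z z) ^ (m + 1)

theorem rieszKernel_of_mem {z : Spacetime (m + 1)} (hz : z ∈ forwardCone (m + 1)) :
    rieszKernel m z = √(mform m z z) ^ (m + 1) :=
  Set.indicator_of_mem hz _

theorem rieszKernel_of_notMem {z : Spacetime (m + 1)} (hz : z ∉ forwardCone (m + 1)) :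
    rieszKernel m z = 0 :=
  Set.indicator_of_notMem hz _

theorem rieszKernel_nonneg (z : Spacetime (m + 1)) : 0 ≤ rieszKernel m z :=
  Set.indicator_nonneg (fun _ _ => by positivity) z

theorem measurable_rieszKernel : Measurable (rieszKernel m) :=
  Measurable.indicator (continuous_mform_self.sqrt.pow _).measurable
    isClosed_forwardCone.measurableSet

theorem rieszKernel_le (z : Spacetime (m + 1)) : rieszKernel m z ≤ ‖z‖ ^ (m + 1) := by
  by_cases hz : z ∈ forwardCone (m + 1)
  · rw [rieszKernel_of_mem hz]
    refine pow_le_pow_left₀ (Real.sqrt_nonneg _) ?_ _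
    rw [Real.sqrt_le_left (norm_nonneg _), norm_sq_eq]
    have h : mform m z z ≤ z 0 ^ 2 := by
      rw [mform_apply]
      have : 0 ≤ ∑ i : Fin m, z i.succ * z i.succ :=
        Finset.sum_nonneg fun _ _ => mul_self_nonneg _
      nlinarith
    linarith
  · rw [rieszKernel_of_notMem hz]
    positivity

theorem locallyIntegrable_rieszKernel : LocallyIntegrable (rieszKernel m) := by
  refine LocallyIntegrable.mono (f := fun z : Spacetime (m + 1) => ‖z‖ ^ (m + 1))
    (by fun_prop : Continuous fun z : Spacetime (m + 1) => ‖z‖ ^ (m + 1)).locallyIntegrable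
    measurable_rieszKernel.aestronglyMeasurable (ae_of_all _ fun z => ?_)
  rw [Real.norm_of_nonneg (rieszKernel_nonneg z), Real.norm_of_nonneg (by positivity)]
  exact rieszKernel_le z

theorem integrable_pow_norm_mul_exp {a : ℝ} (ha : 0 < a) (k : ℕ) :
    Integrable fun z : Spacetime (m + 1) => ‖z‖ ^ k * Real.exp (-(a * ‖z‖)) := by
  -- Bounding the exponential by the power `-N` absorbs `‖z‖ ^ k` and leaves the power `-(m + 2)`,
  -- integrable in dimension `m + 1`.
  set N := k + (m + 2)
  have hJ : Integrable fun z : Spacetime (m + 1) => (1 + ‖z‖) ^ (-((m + 2 : ℕ) : ℝ)) :=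
    integrable_one_add_norm (by simp)
  refine (hJ.const_mul (Real.exp a * N.factorial / a ^ N)).mono'
    (by fun_prop) (ae_of_all _ fun z => ?_)
  rw [Real.norm_of_nonneg (by positivity)]
  have hz : 0 < 1 + ‖z‖ := by positivity
  have h1 : ‖z‖ ^ k ≤ (1 + ‖z‖) ^ k :=
    pow_le_pow_left₀ (norm_nonneg _) (by linarith) _
  have h2 := Real.pow_div_factorial_le_exp (a * (1 + ‖z‖)) (by positivity) N
  have h3 : Real.exp (-(a * ‖z‖)) ≤ Real.exp a * (N.factorial / (a * (1 + ‖z‖)) ^ N) := by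
    have : -(a * ‖z‖) = a + -(a * (1 + ‖z‖)) := by ring
    rw [this, Real.exp_add, Real.exp_neg]
    refine mul_le_mul_of_nonneg_left ?_ (Real.exp_pos _).le
    rw [← inv_div]
    exact inv_anti₀ (by positivity) h2
  rw [Real.rpow_neg hz.le, Real.rpow_natCast]
  calc ‖z‖ ^ k * Real.exp (-(a * ‖z‖))
      ≤ (1 + ‖z‖) ^ k * (Real.exp a * (N.factorial / (a * (1 + ‖z‖)) ^ N)) := by gcongr
    _ = _ := by
      simp only [N, mul_pow, pow_add]
      field_simp

theorem integrable_rieszKernel_mul_exp {a : ℝ} (ha : 0 < a) {X : Spacetime (m + 1) → ℝ}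
    (hX : Measurable X) (h : ∀ z ∈ forwardCone (m + 1), X z ≤ -(a * ‖z‖)) :
    Integrable fun z => rieszKernel m z * Real.exp (X z) := by
  refine (integrable_pow_norm_mul_exp ha (m + 1)).mono'
    (measurable_rieszKernel.mul hX.exp).aestronglyMeasurable (ae_of_all _ fun z => ?_)
  rw [Real.norm_of_nonneg (mul_nonneg (rieszKernel_nonneg z) (Real.exp_pos _).le)]
  by_cases hz : z ∈ forwardCone (m + 1)
  · exact mul_le_mul (rieszKernel_le z) (Real.exp_le_exp.2 (h z hz)) (Real.exp_pos _).le
      (by positivity)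
  · rw [rieszKernel_of_notMem hz, zero_mul]
    positivity

theorem continuous_mform (q : Spacetime (m + 1)) : Continuous (mform m q) :=
  LinearMap.continuous_of_finiteDimensional _

/-! ### The Laplace transform of the kernel, by Lorentz invariance and homogeneity -/

/-- The Laplace transform of the Riesz kernel. -/
def rieszLaplace (q : Spacetime (m + 1)) : ℝ :=
  ∫ z, rieszKernel m z * Real.exp (-mform m q z)

/-- The rotation by `π` around `q + e₀`, which swaps `q` and `e₀` if `γ(q) = 1`. -/
def halfTurn (q : Spacetime (m + 1)) : Spacetime (m + 1) →ₗ[ℝ] Spacetime (m + 1) :=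
  (1 + q 0)⁻¹ • (mform m (q + timeVec m)).smulRight (q + timeVec m) - LinearMap.id

theorem halfTurn_apply (q z : Spacetime (m + 1)) :
    halfTurn q z = ((1 + q 0)⁻¹ * (mform m q z + z 0)) • (q + timeVec m) - z := by
  simp [halfTurn, smul_smul, mform_comm (timeVec m), mform_timeVec]

theorem mform_halfTurn {q : Spacetime (m + 1)} (hq : mform m q q = 1) (hq0 : 0 ≤ q 0)
    (y z : Spacetime (m + 1)) : mform m (halfTurn q y) (halfTurn q z) = mform m y z := by
  have h : 1 + q 0 ≠ 0 := by positivity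
  simp only [halfTurn_apply, map_sub, map_add, map_smul, LinearMap.sub_apply, LinearMap.add_apply,
    LinearMap.smul_apply, hq, mform_timeVec, timeVec_mform, smul_eq_mul, mform_comm y q]
  simp only [PiLp.single_apply, if_true]
  field_simp
  ring

theorem halfTurn_self {q : Spacetime (m + 1)} (hq : mform m q q = 1) (hq0 : 0 ≤ q 0) :
    halfTurn q q = timeVec m := by
  have h : 1 + q 0 ≠ 0 := by positivity
  rw [halfTurn_apply, hq, inv_mul_cancel₀ h, one_smul, add_sub_cancel_left]

theorem halfTurn_halfTurn {q : Spacetime (m + 1)} (hq : mform m q q = 1) (hq0 : 0 ≤ q 0)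
    (z : Spacetime (m + 1)) : halfTurn q (halfTurn q z) = z := by
  have h : 1 + q 0 ≠ 0 := by positivity
  rw [halfTurn_apply q (halfTurn q z)]
  have h1 : mform m q (halfTurn q z) + halfTurn q z 0 = mform m q z + z 0 := by
    have := mform_comm q z
    simp only [halfTurn_apply, map_sub, map_add, map_smul, mform_timeVec, hq, smul_eq_mul,
      PiLp.sub_apply, PiLp.smul_apply, PiLp.add_apply, PiLp.single_apply, if_true]
    field_simp
    ring
  rw [h1, halfTurn_apply]
  abel

theorem halfTurn_mem_forwardCone {q : Spacetime (m + 1)} (hq : mform m q q = 1) (hq0 : 0 ≤ q 0)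
    {z : Spacetime (m + 1)} (hz : z ∈ forwardCone (m + 1)) :
    halfTurn q z ∈ forwardCone (m + 1) := by
  have hqc : q ∈ forwardCone (m + 1) := mem_forwardCone.2 ⟨by rw [hq]; exact zero_le_one, hq0⟩
  rw [mem_forwardCone, mform_halfTurn hq hq0]
  refine ⟨(mem_forwardCone.1 hz).1, ?_⟩
  -- The time component of the image is its pairing with `e₀`, the image of `q`; invariance turns
  -- this into the pairing of `z` with `q`, two vectors of the cone.
  rw [← mform_timeVec, ← halfTurn_self hq hq0, mform_halfTurn hq hq0]
  exact mform_nonneg hz hqc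

theorem rieszKernel_halfTurn {q : Spacetime (m + 1)} (hq : mform m q q = 1) (hq0 : 0 ≤ q 0)
    (z : Spacetime (m + 1)) : rieszKernel m (halfTurn q z) = rieszKernel m z := by
  by_cases hz : z ∈ forwardCone (m + 1)
  · rw [rieszKernel_of_mem hz, rieszKernel_of_mem (halfTurn_mem_forwardCone hq hq0 hz),
      mform_halfTurn hq hq0]
  · rw [rieszKernel_of_notMem hz, rieszKernel_of_notMem]
    intro h
    apply hz
    rw [← halfTurn_halfTurn hq hq0 z]
    exact halfTurn_mem_forwardCone hq hq0 h

/-- An involution has determinant `±1`. -/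
theorem map_halfTurn_volume {q : Spacetime (m + 1)} (hq : mform m q q = 1) (hq0 : 0 ≤ q 0) :
    Measure.map (halfTurn q) volume = volume := by
  have h1 : LinearMap.det (halfTurn q) * LinearMap.det (halfTurn q) = 1 := by
    rw [← LinearMap.det_comp]
    have : halfTurn q ∘ₗ halfTurn q = LinearMap.id :=
      LinearMap.ext fun z => halfTurn_halfTurn hq hq0 z
    rw [this, LinearMap.det_id]
  have h2 : |LinearMap.det (halfTurn q)| = 1 := by
    rcases mul_self_eq_one_iff.1 h1 with h | h <;> simp [h]
  rw [Measure.map_linearMap_addHaar_eq_smul_addHaar _ (left_ne_zero_of_mul_eq_one h1), abs_inv, h2]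
  simp

/-- Substituting the half-turn preserves kernel and volume and moves `q` to `e₀` in the exponent. -/
theorem rieszLaplace_of_unit {q : Spacetime (m + 1)} (hq : mform m q q = 1) (hq0 : 0 ≤ q 0) :
    rieszLaplace q = rieszLaplace (timeVec m) := by
  have hc : Continuous (halfTurn q) := LinearMap.continuous_of_finiteDimensional _
  have hm : Measurable fun z => rieszKernel m z * Real.exp (-mform m q z) :=
    measurable_rieszKernel.mul (continuous_mform q).measurable.neg.exp
  rw [rieszLaplace, ← map_halfTurn_volume hq hq0, integral_map hc.aemeasurable
    hm.aestronglyMeasurable, rieszLaplace]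
  refine integral_congr_ae (ae_of_all _ fun z => ?_)
  dsimp only
  rw [rieszKernel_halfTurn hq hq0]
  congr 3
  nth_rw 1 [← halfTurn_halfTurn hq hq0 q]
  rw [mform_halfTurn hq hq0, halfTurn_self hq hq0]

theorem smul_mem_forwardCone {t : ℝ} (ht : 0 ≤ t) {z : Spacetime (m + 1)}
    (hz : z ∈ forwardCone (m + 1)) : t • z ∈ forwardCone (m + 1) := by
  rw [mem_forwardCone] at *
  have h1 := hz.1
  have h2 := hz.2
  simp only [map_smul, LinearMap.smul_apply, smul_eq_mul, PiLp.smul_apply]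
  exact ⟨by positivity, by positivity⟩

theorem rieszKernel_smul {t : ℝ} (ht : 0 < t) (z : Spacetime (m + 1)) :
    rieszKernel m (t • z) = t ^ (m + 1) * rieszKernel m z := by
  by_cases hz : z ∈ forwardCone (m + 1)
  · rw [rieszKernel_of_mem hz, rieszKernel_of_mem (smul_mem_forwardCone ht.le hz)]
    simp only [map_smul, LinearMap.smul_apply, smul_eq_mul]
    rw [← mul_assoc, Real.sqrt_mul (by positivity), Real.sqrt_mul_self ht.le, mul_pow]
  · rw [rieszKernel_of_notMem hz, rieszKernel_of_notMem, mul_zero]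
    intro h
    apply hz
    simpa [smul_smul, ht.ne'] using smul_mem_forwardCone (inv_nonneg.2 ht.le) h

/-- One factor `t ^ (m + 1)` is the homogeneity of the kernel, the other the Jacobian of the
scaling. -/
theorem rieszLaplace_smul {t : ℝ} (ht : 0 < t) (q : Spacetime (m + 1)) :
    (t ^ 2) ^ (m + 1) * rieszLaplace (t • q) = rieszLaplace q := by
  have h := Measure.integral_comp_smul_of_nonneg volume
    (fun z => rieszKernel m z * Real.exp (-mform m q z)) t (hR := ht.le)
  rw [finrank_euclideanSpace, Fintype.card_fin, smul_eq_mul, eq_inv_mul_iff_mul_eq₀ (by positivity)]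
    at h
  rw [rieszLaplace, rieszLaplace, ← h, ← pow_mul, two_mul, pow_add, mul_assoc,
    ← integral_const_mul]
  simp [rieszKernel_smul ht, mul_assoc]

/-- Rescaling by `√γ(q)` reduces to the unit hyperboloid, where the half-turn applies. -/
theorem rieszLaplace_of_timelike {q : Spacetime (m + 1)} (hq : 0 < mform m q q) (hq0 : 0 ≤ q 0) :
    mform m q q ^ (m + 1) * rieszLaplace q = rieszLaplace (timeVec m) := by
  have hs := Real.sqrt_pos.2 hq
  have h1 : mform m ((√(mform m q q))⁻¹ • q) ((√(mform m q q))⁻¹ • q) = 1 := by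
    simp only [map_smul, LinearMap.smul_apply, smul_eq_mul]
    rw [← mul_assoc, ← mul_inv, Real.mul_self_sqrt hq.le, inv_mul_cancel₀ hq.ne']
  have h2 : 0 ≤ ((√(mform m q q))⁻¹ • q) 0 := by
    simp only [PiLp.smul_apply, smul_eq_mul]
    positivity
  rw [← rieszLaplace_of_unit h1 h2, ← rieszLaplace_smul hs (_ • q), Real.sq_sqrt hq.le, smul_smul,
    mul_inv_cancel₀ hs.ne', one_smul]

theorem integrable_rieszKernel_mul_exp_neg_time :
    Integrable fun z : Spacetime (m + 1) => rieszKernel m z * Real.exp (-z 0) := by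
  refine integrable_rieszKernel_mul_exp (a := 1 / 2) (by norm_num) (by fun_prop) fun z hz => ?_
  have := norm_le_of_mem_forwardCone hz
  linarith

theorem rieszLaplace_timeVec_pos : 0 < rieszLaplace (timeVec m) := by
  simp only [rieszLaplace, timeVec_mform]
  rw [integral_pos_iff_support_of_nonneg
    (fun z => mul_nonneg (rieszKernel_nonneg z) (Real.exp_pos _).le)
    integrable_rieszKernel_mul_exp_neg_time]
  have hU : IsOpen ({z : Spacetime (m + 1) | 0 < mform m z z} ∩ {z | 0 < z 0}) :=
    (isOpen_lt continuous_const continuous_mform_self).inter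
      (isOpen_lt continuous_const (by fun_prop))
  refine (hU.measure_pos volume ⟨timeVec m, by simp [mform_timeVec]⟩).trans_le
    (measure_mono fun z hz => ?_)
  have h1 : 0 < mform m z z := hz.1
  have h2 : 0 < z 0 := hz.2
  rw [Function.mem_support, rieszKernel_of_mem (mem_forwardCone.2 ⟨h1.le, h2.le⟩)]
  positivity

/-! ### Analytic continuation to imaginary arguments -/

/-- The finite measure with density `rieszKernel m z * exp (-z⁰)`. -/
def rieszMeasure (m : ℕ) : Measure (Spacetime (m + 1)) :=
  volume.withDensity fun z => ENNReal.ofReal (rieszKernel m z * Real.exp (-z 0))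

theorem measurable_rieszDensity :
    Measurable fun z : Spacetime (m + 1) => rieszKernel m z * Real.exp (-z 0) :=
  measurable_rieszKernel.mul (by fun_prop)

theorem rieszDensity_nonneg (z : Spacetime (m + 1)) : 0 ≤ rieszKernel m z * Real.exp (-z 0) :=
  mul_nonneg (rieszKernel_nonneg z) (Real.exp_pos _).le

theorem integral_rieszMeasure {E : Type*} [NormedAddCommGroup E] [NormedSpace ℝ E]
    (g : Spacetime (m + 1) → E) :
    ∫ z, g z ∂rieszMeasure m = ∫ z, (rieszKernel m z * Real.exp (-z 0)) • g z := by
  rw [rieszMeasure, integral_withDensity_eq_integral_toReal_smul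
    measurable_rieszDensity.ennreal_ofReal (ae_of_all _ fun _ => ENNReal.ofReal_lt_top)]
  simp [ENNReal.toReal_ofReal (rieszDensity_nonneg _)]

/-- The weight `exp (-z⁰)` shifts the Laplace variable by `e₀`, so the moment generating function
traces the transform along a line through `e₀`. -/
theorem mgf_rieszMeasure (q : Spacetime (m + 1)) (t : ℝ) :
    mgf (fun z => -mform m q z) (rieszMeasure m) t = rieszLaplace (timeVec m + t • q) := by
  rw [mgf, integral_rieszMeasure, rieszLaplace]
  congr 1 with z
  simp only [map_add, map_smul, LinearMap.add_apply, LinearMap.smul_apply, timeVec_mform,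
    smul_eq_mul, mul_assoc, ← Real.exp_add]
  ring_nf

theorem zero_mem_interior_integrableExpSet (q : Spacetime (m + 1)) :
    (0 : ℝ) ∈ interior (integrableExpSet (fun z => -mform m q z) (rieszMeasure m)) := by
  set C := ‖(mform m q).toContinuousLinearMap‖ + 1
  have hC : 0 < C := by positivity
  have hb (z : Spacetime (m + 1)) : |mform m q z| ≤ C * ‖z‖ :=
    ((mform m q).toContinuousLinearMap.le_opNorm z).trans
      (mul_le_mul_of_nonneg_right (by simp [C]) (norm_nonneg z))
  rw [mem_interior_iff_mem_nhds]
  -- On the cone `z⁰ ≥ ‖z‖ / 2`. For `|t| < 1 / (4C)` the perturbation costs at most `‖z‖ / 4`,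
  -- which leaves decay at rate `1 / 4`.
  filter_upwards [Metric.ball_mem_nhds (0 : ℝ) (show 0 < 1 / (4 * C) by positivity)] with t ht
  rw [mem_ball_zero_iff, Real.norm_eq_abs, lt_div_iff₀ (by positivity)] at ht
  rw [integrableExpSet, Set.mem_ofPred_eq, rieszMeasure, integrable_withDensity_iff
    measurable_rieszDensity.ennreal_ofReal (ae_of_all _ fun _ => ENNReal.ofReal_lt_top)]
  have h := integrable_rieszKernel_mul_exp (m := m) (a := 1 / 4) (by norm_num)
    (X := fun z => t * -mform m q z + -z 0)
    (((continuous_mform q).measurable.neg.const_mul t).add (by fun_prop)) fun z hz => by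
      have h1 := norm_le_of_mem_forwardCone hz
      have h2 : |t * -mform m q z| ≤ |t| * (C * ‖z‖) := by
        rw [abs_mul, abs_neg]
        exact mul_le_mul_of_nonneg_left (hb z) (abs_nonneg t)
      have h3 : |t| * (C * ‖z‖) ≤ 1 / 4 * ‖z‖ := by
        rw [← mul_assoc]
        exact mul_le_mul_of_nonneg_right (by linarith) (norm_nonneg z)
      have h4 := le_abs_self (t * -mform m q z)
      linarith
  refine h.congr (ae_of_all _ fun z => ?_)
  dsimp only
  rw [ENNReal.toReal_ofReal (rieszDensity_nonneg z), Real.exp_add]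
  ring

/-- The Laplace transform of the Riesz kernel on the complex line `e₀ + λ q`. -/
theorem mul_complexMGF_rieszMeasure (q : Spacetime (m + 1)) {l : ℂ} (hl : l.re = 0) :
    (1 + 2 * l * q 0 + l ^ 2 * mform m q q) ^ (m + 1) *
      complexMGF (fun z => -mform m q z) (rieszMeasure m) l = rieszLaplace (timeVec m) := by
  set X : Spacetime (m + 1) → ℝ := fun z => -mform m q z
  set S := {z : ℂ | z.re ∈ interior (integrableExpSet X (rieszMeasure m))}
  have h0 : (0 : ℝ) ∈ interior (integrableExpSet X (rieszMeasure m)) :=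
    zero_mem_interior_integrableExpSet q
  have hf : AnalyticOnNhd ℂ (fun l : ℂ => (1 + 2 * l * q 0 + l ^ 2 * mform m q q) ^ (m + 1) *
      complexMGF X (rieszMeasure m) l) S := by
    refine AnalyticOnNhd.mul (fun z _ => ?_) analyticOnNhd_complexMGF
    fun_prop
  have hreal (t : ℝ) : mform m (timeVec m + t • q) (timeVec m + t • q)
      = 1 + 2 * t * q 0 + t ^ 2 * mform m q q := by
    simp only [map_add, map_smul, LinearMap.add_apply, LinearMap.smul_apply, timeVec_mform,
      mform_timeVec, smul_eq_mul, PiLp.single_apply, if_true]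
    ring
  -- For small real `t` the vector `e₀ + t q` is still future timelike, so the real Laplace formula
  -- applies.
  have hev : ∀ᶠ t : ℝ in 𝓝 0, (1 + 2 * (t : ℂ) * q 0 + (t : ℂ) ^ 2 * mform m q q) ^ (m + 1) *
      complexMGF X (rieszMeasure m) t = rieszLaplace (timeVec m) := by
    have h1 : ∀ᶠ t : ℝ in 𝓝 0, 0 < 1 + 2 * t * q 0 + t ^ 2 * mform m q q :=
      (show Continuous fun t : ℝ => 1 + 2 * t * q 0 + t ^ 2 * mform m q q by
        fun_prop).continuousAt.eventually_const_lt (by simp)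
    have h2 : ∀ᶠ t : ℝ in 𝓝 0, 0 < 1 + t * q 0 :=
      (show Continuous fun t : ℝ => 1 + t * q 0 by
        fun_prop).continuousAt.eventually_const_lt (by simp)
    filter_upwards [h1, h2] with t ht1 ht2
    rw [complexMGF_ofReal, mgf_rieszMeasure, ← rieszLaplace_of_timelike (q := timeVec m + t • q)
      (by rwa [hreal]) (by simpa using ht2.le), hreal]
    push_cast
    ring
  -- Identity theorem: `S` is a vertical strip, hence connected; it contains the imaginary axis, and
  -- the real points where equality holds accumulate at `0`.
  refine AnalyticOnNhd.eqOn_of_preconnected_of_frequently_eq hf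
    (analyticOnNhd_const (v := ((rieszLaplace (timeVec m) : ℝ) : ℂ)))
    (convex_integrableExpSet.interior.linear_preimage Complex.reLm).isPreconnected
    (z₀ := 0) (by simpa [S] using h0) ?_ (by simpa [S, hl] using h0)
  have htend : Tendsto (fun t : ℝ => (t : ℂ)) (𝓝[≠] 0) (𝓝[≠] 0) := by
    refine tendsto_nhdsWithin_of_tendsto_nhds_of_eventually_within _ ?_ ?_
    · exact (Complex.continuous_ofReal.tendsto' 0 0 (by simp)).mono_left nhdsWithin_le_nhds
    · filter_upwards [self_mem_nhdsWithin] with t ht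
      simpa using ht
  exact htend.frequently (hev.filter_mono nhdsWithin_le_nhds).frequently

/-! ### Retarded convolution on past-compact functions -/

/-- Convolution with the Riesz kernel. -/
def rieszConv (f : Spacetime (m + 1) → ℝ) (x : Spacetime (m + 1)) : ℝ :=
  ∫ z, rieszKernel m z * f (x - z)

/-- The kernel lives on the forward cone, so only `J⁻(x)` contributes. -/
theorem rieszConv_congr {f g : Spacetime (m + 1) → ℝ} {x : Spacetime (m + 1)}
    (h : ∀ y ∈ causalPast x, f y = g y) : rieszConv f x = rieszConv g x := by
  refine integral_congr_ae (ae_of_all _ fun z => ?_)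
  by_cases hz : z ∈ forwardCone (m + 1)
  · dsimp only
    rw [h (x - z) (by rwa [causalPast, Set.mem_ofPred_eq, sub_sub_cancel])]
  · simp [rieszKernel_of_notMem hz]

theorem rieszConv_eq_zero {f : Spacetime (m + 1) → ℝ} {x : Spacetime (m + 1)}
    (hx : x ∉ causalFuture (tsupport f)) : rieszConv f x = 0 := by
  rw [rieszConv_congr (g := fun _ => 0)]
  · simp [rieszConv]
  · intro y hy
    by_contra h
    exact hx ⟨y, subset_tsupport f h, hy⟩

theorem rieszConv_eventuallyEq {f g : Spacetime (m + 1) → ℝ} {x : Spacetime (m + 1)}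
    (h : ∀ y ∈ causalPast (x + timeVec m), g =ᶠ[𝓝 y] f) : rieszConv g =ᶠ[𝓝 x] rieszConv f := by
  filter_upwards [causalPast_mem_nhds x] with x' hx'
  exact rieszConv_congr fun y hy => (h y (causalPast_trans hy hx')).eq_of_nhds

open scoped Convolution in
theorem rieszConv_eq_convolution (g : Spacetime (m + 1) → ℝ) :
    rieszConv g = rieszKernel m ⋆[ContinuousLinearMap.mul ℝ ℝ] g := by
  ext x
  rw [convolution_mul, rieszConv]

theorem fderiv_rieszConv {g : SmoothPC (m + 1)} (hg : HasCompactSupport g.1)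
    (a : Fin (m + 1)) (x : Spacetime (m + 1)) :
    fderiv ℝ (rieszConv g.1) x (EuclideanSpace.single a 1) = rieszConv (pd a g).1 x := by
  have hg1 : ContDiff ℝ 1 g.1 := g.2.1.of_le (by simp)
  rw [rieszConv_eq_convolution, (hg.hasFDerivAt_convolution_right (ContinuousLinearMap.mul ℝ ℝ)
    locallyIntegrable_rieszKernel hg1 x).fderiv,
    convolution_precompR_apply _ locallyIntegrable_rieszKernel (hg.fderiv ℝ)
    (hg1.continuous_fderiv one_ne_zero), rieszConv_eq_convolution]
  rfl

/-- Smoothness is local: near `x` the function may be cut off outside `J⁻(x + e₀)`, and a compactly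
supported smooth function has a smooth convolution. -/
theorem contDiff_rieszConv (f : SmoothPC (m + 1)) : ContDiff ℝ ∞ (rieszConv f.1) := by
  rw [contDiff_iff_contDiffAt]
  intro x
  obtain ⟨g, hg, hgf⟩ := exists_hasCompactSupport_eventuallyEq f (x + timeVec m)
  have h : ContDiff ℝ ∞ (rieszConv g.1) := by
    rw [rieszConv_eq_convolution]
    exact hg.contDiff_convolution_right _ locallyIntegrable_rieszKernel g.2.1
  exact h.contDiffAt.congr_of_eventuallyEq (rieszConv_eventuallyEq hgf).symm

theorem tsupport_rieszConv_subset (f : SmoothPC (m + 1)) :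
    tsupport (rieszConv f.1) ⊆ causalFuture (tsupport f.1) := by
  refine closure_minimal (fun x hx => ?_) f.2.2.causalFuture.isClosed
  by_contra h
  exact hx (rieszConv_eq_zero h)

theorem integrable_rieszKernel_mul (f : SmoothPC (m + 1)) (x : Spacetime (m + 1)) :
    Integrable fun z => rieszKernel m z * f.1 (x - z) := by
  obtain ⟨g, hg, hgf⟩ := exists_hasCompactSupport_eventuallyEq f x
  have h : Integrable fun z => rieszKernel m z * g.1 (x - z) :=
    hg.convolutionExists_right (ContinuousLinearMap.mul ℝ ℝ) locallyIntegrable_rieszKernel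
      g.2.1.continuous x
  refine h.congr (ae_of_all _ fun z => ?_)
  by_cases hz : z ∈ forwardCone (m + 1)
  · dsimp only
    rw [(hgf (x - z) (by rwa [causalPast, Set.mem_ofPred_eq, sub_sub_cancel])).eq_of_nhds]
  · simp [rieszKernel_of_notMem hz]

/-- Convolution with the Riesz kernel as an operator on `C^∞_pc`. -/
def rieszOp (m : ℕ) : SmoothPC (m + 1) →ₗ[ℝ] SmoothPC (m + 1) where
  toFun f := ⟨rieszConv f.1, contDiff_rieszConv f,
    f.2.2.causalFuture.mono (isClosed_tsupport _) (tsupport_rieszConv_subset f)⟩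
  map_add' f g := by
    ext x
    change ∫ z, rieszKernel m z * (f.1 (x - z) + g.1 (x - z)) = _
    simp_rw [mul_add]
    exact integral_add (integrable_rieszKernel_mul f x) (integrable_rieszKernel_mul g x)
  map_smul' c f := by
    ext x
    change ∫ z, rieszKernel m z * (c * f.1 (x - z)) = c * ∫ z, rieszKernel m z * f.1 (x - z)
    simp_rw [mul_left_comm _ c]
    exact integral_const_mul _ _

theorem pd_eventuallyEq {n : ℕ} {f g : SmoothPC n} {x : Spacetime n} (h : f.1 =ᶠ[𝓝 x] g.1)
    (a : Fin n) : (pd a f).1 =ᶠ[𝓝 x] (pd a g).1 := by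
  filter_upwards [h.fderiv (𝕜 := ℝ)] with y hy
  change fderiv ℝ f.1 y _ = fderiv ℝ g.1 y _
  rw [hy]

theorem pd_rieszOp (a : Fin (m + 1)) (f : SmoothPC (m + 1)) :
    pd a (rieszOp m f) = rieszOp m (pd a f) := by
  ext x
  obtain ⟨g, hg, hgf⟩ := exists_hasCompactSupport_eventuallyEq f (x + timeVec m)
  change fderiv ℝ (rieszConv f.1) x _ = rieszConv (pd a f).1 x
  rw [← (rieszConv_eventuallyEq hgf).fderiv_eq, fderiv_rieszConv hg]
  exact (rieszConv_eventuallyEq fun y hy => pd_eventuallyEq (hgf y hy) a).eq_of_nhds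

theorem box_eq (f : SmoothPC (m + 1)) :
    box f = -pd 0 (pd 0 f) + ∑ i : Fin m, pd i.succ (pd i.succ f) := by
  rw [← sum_eta_smul fun a b => pd a (pd b f)]
  simp [box]

theorem box_rieszOp (f : SmoothPC (m + 1)) : box (rieszOp m f) = rieszOp m (box f) := by
  simp [box_eq, pd_rieszOp]

theorem box_pow_rieszOp (k : ℕ) (f : SmoothPC (m + 1)) :
    (box ^ k) (rieszOp m f) = rieszOp m ((box ^ k) f) := by
  induction k with
  | zero => rfl
  | succ k ih => rw [pow_succ', Module.End.mul_apply, ih, box_rieszOp, Module.End.mul_apply]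

/-! ### Locality of the powers of `□` -/

theorem coe_box {n : ℕ} (f : SmoothPC n) :
    (box f).1 = fun x => ∑ a, ∑ b, eta n a b * (pd a (pd b f)).1 x := by
  ext x
  simp [box]

theorem tsupport_pd_subset {n : ℕ} (a : Fin n) (f : SmoothPC n) :
    tsupport (pd a f).1 ⊆ tsupport f.1 :=
  tsupport_fderiv_apply_subset ℝ _

theorem tsupport_box_subset {n : ℕ} (f : SmoothPC n) : tsupport (box f).1 ⊆ tsupport f.1 := by
  refine closure_minimal (fun x hx => ?_) (isClosed_tsupport _)
  by_contra h
  apply hx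
  have h0 (a b : Fin n) : (pd a (pd b f)).1 x = 0 := image_eq_zero_of_notMem_tsupport fun hx =>
    h (tsupport_pd_subset b f (tsupport_pd_subset a _ hx))
  simp [coe_box, h0]

theorem tsupport_box_pow_subset {n : ℕ} (k : ℕ) (f : SmoothPC n) :
    tsupport ((box ^ k) f).1 ⊆ tsupport f.1 := by
  induction k with
  | zero => exact subset_rfl
  | succ k ih =>
    rw [pow_succ', Module.End.mul_apply]
    exact (tsupport_box_subset _).trans ih

theorem box_eventuallyEq {n : ℕ} {f g : SmoothPC n} {x : Spacetime n} (h : f.1 =ᶠ[𝓝 x] g.1) :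
    (box f).1 =ᶠ[𝓝 x] (box g).1 := by
  have h1 : ∀ a b, ∀ᶠ y in 𝓝 x, (pd a (pd b f)).1 y = (pd a (pd b g)).1 y := fun a b =>
    pd_eventuallyEq (pd_eventuallyEq h b) a
  simp_rw [← eventually_all] at h1
  filter_upwards [h1] with y hy
  simp [coe_box, hy]

theorem box_pow_eventuallyEq {n : ℕ} {f g : SmoothPC n} {x : Spacetime n} (h : f.1 =ᶠ[𝓝 x] g.1)
    (k : ℕ) : ((box ^ k) f).1 =ᶠ[𝓝 x] ((box ^ k) g).1 := by
  induction k with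
  | zero => exact h
  | succ k ih =>
    simp only [pow_succ', Module.End.mul_apply]
    exact box_eventuallyEq ih

/-! ### Fourier inversion of the convolution -/

/-- The Schwartz function `z ↦ exp (z⁰) g (x - z)`. -/
def expReflect (x : Spacetime (m + 1)) (g : SmoothPC (m + 1)) (hg : HasCompactSupport g.1) :
    𝓢(Spacetime (m + 1), ℂ) :=
  HasCompactSupport.toSchwartzMap (f := fun z => ((Real.exp (z 0) * g.1 (x - z) : ℝ) : ℂ))
    ((hg.comp_homeomorph (Homeomorph.subLeft x)).mul_left.comp_left Complex.ofReal_zero)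
    (Complex.ofRealCLM.contDiff.comp (ContDiff.mul (by fun_prop)
      (g.2.1.comp (by fun_prop : ContDiff ℝ ∞ fun z : Spacetime (m + 1) => x - z))))

theorem expReflect_apply (x : Spacetime (m + 1)) (g : SmoothPC (m + 1))
    (hg : HasCompactSupport g.1) (z : Spacetime (m + 1)) :
    expReflect x g hg z = ((Real.exp (z 0) * g.1 (x - z) : ℝ) : ℂ) := rfl

theorem hasCompactSupport_pd {n : ℕ} {g : SmoothPC n} (hg : HasCompactSupport g.1) (a : Fin n) :
    HasCompactSupport (pd a g).1 :=
  hg.mono' ((subset_tsupport _).trans (tsupport_pd_subset a g))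

theorem hasCompactSupport_box {n : ℕ} {g : SmoothPC n} (hg : HasCompactSupport g.1) :
    HasCompactSupport (box g).1 :=
  hg.mono' ((subset_tsupport _).trans (tsupport_box_subset g))

theorem hasCompactSupport_box_pow {n : ℕ} {g : SmoothPC n} (hg : HasCompactSupport g.1) (k : ℕ) :
    HasCompactSupport ((box ^ k) g).1 :=
  hg.mono' ((subset_tsupport _).trans (tsupport_box_pow_subset k g))

/-- Differentiating `exp (z⁰) g (x - z)` gives the function itself if `a = 0`, from the exponential,
minus the term with `∂_a g`, the sign coming from the reflection. -/
theorem expReflect_pd (x : Spacetime (m + 1)) (g : SmoothPC (m + 1)) (hg : HasCompactSupport g.1)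
    (a : Fin (m + 1)) :
    expReflect x (pd a g) (hasCompactSupport_pd hg a)
      = (if a = 0 then (1 : ℂ) else 0) • expReflect x g hg
        - ∂_{(EuclideanSpace.single a 1 : Spacetime (m + 1))} (expReflect x g hg) := by
  ext z
  have hg1 : DifferentiableAt ℝ g.1 (x - z) := g.2.1.contDiffAt.differentiableAt (by simp)
  have h1 : HasFDerivAt (fun z : Spacetime (m + 1) => g.1 (x - z))
      ((fderiv ℝ g.1 (x - z)).comp (-ContinuousLinearMap.id ℝ _)) z :=
    hg1.hasFDerivAt.comp z ((hasFDerivAt_id z).const_sub x)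
  have h2 : HasFDerivAt (fun z : Spacetime (m + 1) => Real.exp (z 0))
      (Real.exp (z 0) • (EuclideanSpace.proj 0 : Spacetime (m + 1) →L[ℝ] ℝ)) z :=
    (EuclideanSpace.proj 0 : Spacetime (m + 1) →L[ℝ] ℝ).hasFDerivAt.exp
  have h3 := Complex.ofRealCLM.hasFDerivAt.comp z (h2.mul h1)
  have h4 : fderiv ℝ (expReflect x g hg) z = _ := h3.fderiv
  simp only [sub_apply, smul_apply, SchwartzMap.lineDerivOp_apply_eq_fderiv,
    h4, expReflect_apply]
  change ((Real.exp (z 0) * fderiv ℝ g.1 (x - z) (EuclideanSpace.single a 1) : ℝ) : ℂ) = _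
  by_cases ha : a = 0
  · subst ha
    simp
    ring
  · simp [ha, Ne.symm ha]

theorem fourier_expReflect_pd (x : Spacetime (m + 1)) (g : SmoothPC (m + 1))
    (hg : HasCompactSupport g.1) (a : Fin (m + 1)) (ξ : Spacetime (m + 1)) :
    𝓕 (expReflect x (pd a g) (hasCompactSupport_pd hg a)) ξ
      = ((if a = 0 then (1 : ℂ) else 0) - 2 * Real.pi * Complex.I * ξ a)
        * 𝓕 (expReflect x g hg) ξ := by
  have ht : (fun y : Spacetime (m + 1) =>
      inner ℝ y (EuclideanSpace.single a 1 : Spacetime (m + 1))).HasTemperateGrowth :=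
    ((innerSL ℝ).flip _).hasTemperateGrowth
  rw [expReflect_pd x g hg, sub_eq_add_neg, FourierTransform.fourier_add,
    FourierTransform.fourier_neg, FourierTransform.fourier_smul,
    SchwartzMap.fourier_lineDerivOp_eq, add_apply, neg_apply, smul_apply, smul_apply,
    SchwartzMap.smulLeftCLM_apply_apply ht, EuclideanSpace.inner_single_right]
  simp only [smul_eq_mul, Complex.real_smul, conj_trivial, one_mul]
  ring

/-- The symbol of `-□` conjugated by `exp (z⁰)`. -/
def boxSymbol (ξ : Spacetime (m + 1)) : ℂ :=
  1 + 2 * (-2 * Real.pi * Complex.I) * ξ 0 + (-2 * Real.pi * Complex.I) ^ 2 *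
    ((ξ 0 * ξ 0 - ∑ i : Fin m, ξ i.succ * ξ i.succ : ℝ) : ℂ)

theorem fourier_expReflect_box (x : Spacetime (m + 1)) (g : SmoothPC (m + 1))
    (hg : HasCompactSupport g.1) (ξ : Spacetime (m + 1)) :
    𝓕 (expReflect x (box g) (hasCompactSupport_box hg)) ξ
      = -boxSymbol ξ * 𝓕 (expReflect x g hg) ξ := by
  have hpp (a : Fin (m + 1)) := hasCompactSupport_pd (hasCompactSupport_pd hg a) a
  have h : expReflect x (box g) (hasCompactSupport_box hg)
      = -expReflect x (pd 0 (pd 0 g)) (hpp 0)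
        + ∑ i : Fin m, expReflect x (pd i.succ (pd i.succ g)) (hpp i.succ) := by
    ext z
    simp only [add_apply, neg_apply, sum_apply,
      expReflect_apply, box_eq]
    have hs : (-pd 0 (pd 0 g) + ∑ i : Fin m, pd i.succ (pd i.succ g) : SmoothPC (m + 1)).1 (x - z)
        = -(pd 0 (pd 0 g)).1 (x - z) + ∑ i : Fin m, (pd i.succ (pd i.succ g)).1 (x - z) := by
      simp
    rw [hs]
    push_cast
    rw [mul_add, Finset.mul_sum]
    ring
  rw [h, FourierTransform.fourier_add, FourierTransform.fourier_neg, FourierTransform.fourier_sum]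
  simp only [add_apply, neg_apply, sum_apply,
    fourier_expReflect_pd x _ (hasCompactSupport_pd hg _), fourier_expReflect_pd x g hg,
    if_true, Fin.succ_ne_zero, if_false, boxSymbol]
  have hsum : ∑ i : Fin m, (0 - 2 * (Real.pi : ℂ) * Complex.I * ξ i.succ) *
      ((0 - 2 * (Real.pi : ℂ) * Complex.I * ξ i.succ) * 𝓕 (expReflect x g hg) ξ)
      = (2 * (Real.pi : ℂ) * Complex.I) ^ 2 * (∑ i : Fin m, (ξ i.succ : ℂ) * ξ i.succ) *
        𝓕 (expReflect x g hg) ξ := by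
    rw [Finset.mul_sum, Finset.sum_mul]
    exact Finset.sum_congr rfl fun i _ => by ring
  rw [hsum]
  push_cast
  ring

theorem fourier_expReflect_box_pow (x : Spacetime (m + 1)) (g : SmoothPC (m + 1))
    (hg : HasCompactSupport g.1) (ξ : Spacetime (m + 1)) (k : ℕ) :
    𝓕 (expReflect x ((box ^ k) g) (hasCompactSupport_box_pow hg k)) ξ
      = (-boxSymbol ξ) ^ k * 𝓕 (expReflect x g hg) ξ := by
  induction k with
  | zero => simp
  | succ k ih =>
    simp only [pow_succ', Module.End.mul_apply]
    rw [fourier_expReflect_box x _ (hasCompactSupport_box_pow hg k), ih, mul_assoc]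

/-- Flipping the spatial signs of `ξ` gives a `q` whose Minkowski pairing with `z` is the Euclidean
`⟨z, ξ⟩`. At `l = 2πi` the complex moment generating function is then the Fourier transform;
`boxSymbol` is built with `-2πi`, hence the argument `-ξ`. -/
theorem boxSymbol_neg_pow_mul_fourier (ξ : Spacetime (m + 1)) :
    boxSymbol (-ξ) ^ (m + 1) *
      𝓕 (fun z : Spacetime (m + 1) => ((rieszKernel m z * Real.exp (-z 0) : ℝ) : ℂ)) ξ
      = rieszLaplace (timeVec m) := by
  set q : Spacetime (m + 1) :=
    WithLp.toLp 2 (Fin.cons (ξ 0) fun i : Fin m => -ξ i.succ)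
  have hq0 : q 0 = ξ 0 := rfl
  have hqs (i : Fin m) : q i.succ = -ξ i.succ := rfl
  have hqz (z : Spacetime (m + 1)) : mform m q z = inner ℝ z ξ := by
    rw [mform_apply, PiLp.inner_apply, Fin.sum_univ_succ]
    simp [hq0, hqs]
  rw [← mul_complexMGF_rieszMeasure q (l := 2 * Real.pi * Complex.I) (by simp)]
  congr 1
  · rw [boxSymbol, mform_apply, hq0]
    simp only [hqs, PiLp.neg_apply]
    push_cast
    ring
  · rw [ProbabilityTheory.complexMGF, integral_rieszMeasure, Real.fourier_eq']
    refine integral_congr_ae (ae_of_all _ fun z => ?_)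
    dsimp only
    rw [hqz, smul_eq_mul, mul_comm, Complex.real_smul]
    push_cast
    ring_nf

/-- `rieszConv` inverts `□^n` up to a constant, for compact supports. -/
theorem rieszConv_box_pow_of_hasCompactSupport (g : SmoothPC (m + 1))
    (hg : HasCompactSupport g.1) (x : Spacetime (m + 1)) :
    rieszConv ((box ^ (m + 1)) g).1 x
      = (-1) ^ (m + 1) * rieszLaplace (timeVec m) * g.1 x := by
  set κ : Spacetime (m + 1) → ℂ := fun z => ((rieszKernel m z * Real.exp (-z 0) : ℝ) : ℂ)
  have hκ : Integrable κ := integrable_rieszKernel_mul_exp_neg_time.ofReal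
  set h := expReflect x ((box ^ (m + 1)) g) (hasCompactSupport_box_pow hg (m + 1))
  set s := expReflect x g hg
  -- The factors `exp (-z⁰)` in `κ` and `exp (z⁰)` in `h` cancel.
  have h1 : ((rieszConv ((box ^ (m + 1)) g).1 x : ℝ) : ℂ) = ∫ z, κ z • h z := by
    rw [rieszConv, ← integral_complex_ofReal]
    refine integral_congr_ae (ae_of_all _ fun z => ?_)
    simp only [h, κ, expReflect_apply, smul_eq_mul, Real.exp_neg]
    have := (Real.exp_pos (z 0)).ne'
    rw [← Complex.ofReal_mul]
    congr 1
    field_simp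
  -- Multiplication formula `∫ κ · 𝓕 u = ∫ 𝓕 κ · u` with `u = 𝓕⁻ h`.
  have h2 : ∫ z, κ z • h z = ∫ ξ, 𝓕 κ ξ • (𝓕⁻ h) ξ := by
    have := VectorFourier.integral_fourierIntegral_smul_eq_flip (L := innerₗ (Spacetime (m + 1)))
      (μ := volume) (ν := volume) Real.continuous_fourierChar
      (by exact continuous_inner) hκ (𝓕⁻ h).integrable
    rw [flip_innerₗ] at this
    refine Eq.trans ?_ this.symm
    have h3 : 𝓕 (𝓕⁻ h) = h := FourierTransform.fourier_fourierInv_eq h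
    nth_rw 1 [← h3]
    rfl
  -- The inverse transform is the transform at `-ξ`, where `□^n` acts as `(-boxSymbol (-ξ))^n`; the
  -- transform of `κ` cancels this power up to the constant.
  have h4 (ξ : Spacetime (m + 1)) : 𝓕 κ ξ • (𝓕⁻ h) ξ
      = ((-1) ^ (m + 1) * rieszLaplace (timeVec m) : ℂ) * (𝓕⁻ s) ξ := by
    rw [SchwartzMap.fourierInv_coe, SchwartzMap.fourierInv_coe, Real.fourierInv_eq_fourier_neg,
      Real.fourierInv_eq_fourier_neg, ← SchwartzMap.fourier_coe, ← SchwartzMap.fourier_coe,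
      fourier_expReflect_box_pow x g hg, ← boxSymbol_neg_pow_mul_fourier ξ, smul_eq_mul, neg_pow]
    ring
  -- Fourier inversion at the origin.
  have h5 : ∫ ξ, (𝓕⁻ s) ξ = s 0 := by
    have h3 : 𝓕 (𝓕⁻ s) = s := FourierTransform.fourier_fourierInv_eq s
    rw [← h3, SchwartzMap.fourier_coe, Real.fourier_eq']
    simp [h3]
  have h6 : s 0 = g.1 x := by simp [s, expReflect_apply]
  have h7 : ((rieszConv ((box ^ (m + 1)) g).1 x : ℝ) : ℂ)
      = ((-1) ^ (m + 1) * rieszLaplace (timeVec m) : ℂ) * g.1 x := by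
    rw [h1, h2, ← h6, ← h5, ← integral_const_mul]
    exact integral_congr_ae (ae_of_all _ h4)
  exact_mod_cast h7

/-- Cut off outside `J⁻(x)`: `□` is local and the convolution at `x` sees only `J⁻(x)`, so the
compactly supported case suffices. -/
theorem rieszOp_box_pow (f : SmoothPC (m + 1)) :
    rieszOp m ((box ^ (m + 1)) f) = ((-1) ^ (m + 1) * rieszLaplace (timeVec m)) • f := by
  ext x
  obtain ⟨g, hg, hgf⟩ := exists_hasCompactSupport_eventuallyEq f x
  have hx : x ∈ causalPast x := by simpa [causalPast] using zero_mem_forwardCone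
  change rieszConv ((box ^ (m + 1)) f).1 x = _ * f.1 x
  rw [← (hgf x hx).eq_of_nhds, ← rieszConv_box_pow_of_hasCompactSupport g hg x]
  exact rieszConv_congr fun y hy => (box_pow_eventuallyEq (hgf y hy) (m + 1)).symm.eq_of_nhds

end Minkowski
end

noncomputable section

namespace Minkowski

open Filter Topology

variable {n : ℕ}

/-! ### Divergences and traces of the parts of the decomposition -/

theorem pd_comm (a b : Fin n) (f : SmoothPC n) : pd a (pd b f) = pd b (pd a f) := by
  have key (a b : Fin n) (x : Spacetime n) : (pd a (pd b f)).1 x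
      = fderiv ℝ (fderiv ℝ f.1) x (EuclideanSpace.single a 1) (EuclideanSpace.single b 1) := by
    have hd : DifferentiableAt ℝ (fderiv ℝ f.1) x :=
      (f.2.1.fderiv_right (m := ∞) le_rfl).contDiffAt.differentiableAt (by simp)
    change fderiv ℝ (fun y => fderiv ℝ f.1 y (EuclideanSpace.single b 1)) x _ = _
    rw [fderiv_clm_apply hd (differentiableAt_const _)]
    simp
  ext x
  rw [key, key]
  exact (f.2.1.contDiffAt.isSymmSndFDerivAt
    (by simpa using WithTop.coe_le_coe.2 (le_top : (2 : ℕ∞) ≤ ⊤))).eq _ _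

/-- The diagonal entries of the metric. -/
def metricSign (a : Fin n) : ℝ := if (a : ℕ) = 0 then -1 else 1

theorem eta_apply (a b : Fin n) : eta n a b = if a = b then metricSign a else 0 := by
  rw [eta, Matrix.diagonal_apply]
  rfl

theorem metricSign_mul_self (a : Fin n) : metricSign a * metricSign a = 1 := by
  unfold metricSign
  split_ifs <;> norm_num

theorem box_eq_sum (f : SmoothPC n) : box f = ∑ a, metricSign a • pd a (pd a f) := by
  simp [box, eta_apply, ite_smul]

theorem divCovector_eq_sum (v : Covector n) :
    divCovector v = ∑ a, metricSign a • pd a (v a) := by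
  simp [divCovector, eta_apply, ite_smul]

theorem divTensor_eq_sum (h : Tensor2 n) (b : Fin n) :
    divTensor h b = ∑ a, metricSign a • pd a (h a b) := by
  simp [divTensor, eta_apply, ite_smul]

theorem trace_eq_sum (h : Tensor2 n) : trace h = ∑ a, metricSign a • h a a := by
  simp [trace, eta_apply, ite_smul]

theorem pd_box (a : Fin n) (f : SmoothPC n) : pd a (box f) = box (pd a f) := by
  simp only [box_eq_sum, map_sum, map_smul]
  refine Finset.sum_congr rfl fun b _ => ?_
  rw [pd_comm a b, pd_comm a b]

theorem box_divCovector (v : Covector n) :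
    box (divCovector v) = divCovector fun b => box (v b) := by
  simp only [divCovector_eq_sum, map_sum, map_smul, pd_box]

theorem divCovector_pd (f : SmoothPC n) : divCovector (fun b => pd b f) = box f := by
  rw [divCovector_eq_sum, box_eq_sum]

theorem divCovector_add (u v : Covector n) :
    divCovector (u + v) = divCovector u + divCovector v := by
  simp only [divCovector_eq_sum, Pi.add_apply, map_add, smul_add, Finset.sum_add_distrib]

theorem divCovector_smul (c : ℝ) (v : Covector n) : divCovector (c • v) = c • divCovector v := by
  simp only [divCovector_eq_sum, Pi.smul_apply, map_smul, Finset.smul_sum, smul_comm c]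

theorem divTensor_add (h k : Tensor2 n) : divTensor (h + k) = divTensor h + divTensor k := by
  ext1 b
  simp only [Pi.add_apply, divTensor_eq_sum, Matrix.add_apply, map_add, smul_add,
    Finset.sum_add_distrib]

theorem trace_add (h k : Tensor2 n) : trace (h + k) = trace h + trace k := by
  simp only [trace_eq_sum, Matrix.add_apply, smul_add, Finset.sum_add_distrib]

theorem divTensor_vectorPart (v : Covector n) (b : Fin n) :
    divTensor (vectorPart v) b = box (v b) + pd b (divCovector v) := by
  simp only [divTensor_eq_sum, vectorPart, box_eq_sum, divCovector_eq_sum, map_add, smul_add,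
    Finset.sum_add_distrib, map_sum, map_smul, pd_comm b]

theorem trace_vectorPart (v : Covector n) :
    trace (vectorPart v) = (2 : ℝ) • divCovector v := by
  simp only [trace_eq_sum, vectorPart, divCovector_eq_sum, smul_add, Finset.sum_add_distrib,
    two_smul]

theorem sum_metricSign_smul_eta (F : Fin n → SmoothPC n) (b : Fin n) :
    ∑ a, metricSign a • eta n a b • F a = F b := by
  rw [Finset.sum_eq_single b]
  · rw [eta_apply, if_pos rfl, smul_smul, metricSign_mul_self, one_smul]
  · intro a _ ha
    rw [eta_apply, if_neg ha, zero_smul, smul_zero]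
  · simp

/-- The Hessian contributes `∂_b □ w`, and its trace correction removes the fraction `1 / n` of it.
-/
theorem divTensor_scalarPart (hn : n ≠ 0) (w t : SmoothPC n) (b : Fin n) :
    divTensor (scalarPart w t) b
      = (((n : ℝ) - 1) / n) • pd b (box w) + (1 / (n : ℝ)) • pd b t := by
  have hn' : (n : ℝ) ≠ 0 := Nat.cast_ne_zero.2 hn
  have h1 : ∑ a, metricSign a • pd a (pd a (pd b w)) = pd b (box w) := by
    rw [← box_eq_sum, pd_box]
  have h2 (X : SmoothPC n) : ∑ a, metricSign a • (1 / (n : ℝ)) • eta n a b • pd a X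
      = (1 / (n : ℝ)) • pd b X := by
    simp_rw [smul_comm (metricSign _) (1 / (n : ℝ))]
    rw [← Finset.smul_sum, sum_metricSign_smul_eta fun a => pd a X]
  simp only [divTensor_eq_sum, scalarPart, map_add, map_sub, map_smul, smul_add, smul_sub,
    Finset.sum_add_distrib, Finset.sum_sub_distrib, h1, h2, sub_div, div_self hn']
  module

/-- Since `η^{ab} η_{ab} = n`, the operator applied to `w` is traceless and the last term has trace
`t`. -/
theorem trace_scalarPart (hn : n ≠ 0) (w t : SmoothPC n) : trace (scalarPart w t) = t := by
  have hn' : (n : ℝ) ≠ 0 := Nat.cast_ne_zero.2 hn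
  have h2 (X : SmoothPC n) : ∑ a, metricSign a • (1 / (n : ℝ)) • eta n a a • X = X := by
    have h (a : Fin n) : metricSign a • (1 / (n : ℝ)) • eta n a a • X = (1 / (n : ℝ)) • X := by
      rw [eta_apply, if_pos rfl, smul_comm, smul_smul (metricSign a), metricSign_mul_self, one_smul]
    simp_rw [h]
    rw [Finset.sum_const, Finset.card_univ, Fintype.card_fin, ← Nat.cast_smul_eq_nsmul ℝ,
      smul_smul, mul_one_div_cancel hn', one_smul]
  simp only [trace_eq_sum, scalarPart, smul_add, smul_sub, Finset.sum_add_distrib,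
    Finset.sum_sub_distrib, h2, ← box_eq_sum]
  simp

theorem isSymm_scalarPart (w t : SmoothPC n) : (scalarPart w t).IsSymm := by
  refine Matrix.IsSymm.ext fun a b => ?_
  have h : eta n a b = eta n b a := by
    simp only [eta_apply, eq_comm (a := b)]
    split_ifs with h <;> simp [h]
  simp only [scalarPart, h, pd_comm a b]

theorem isSymm_vectorPart (v : Covector n) : (vectorPart v).IsSymm :=
  Matrix.IsSymm.ext fun _ _ => add_comm _ _

/-! ### Solving for the decomposition -/

theorem IsRetardedGreenOperator.box_injective {G : SmoothPC n →ₗ[ℝ] SmoothPC n}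
    (hG : IsRetardedGreenOperator G) : Function.Injective (box : SmoothPC n →ₗ[ℝ] SmoothPC n) :=
  Function.LeftInverse.injective hG.apply_box

/-- The divergence kills the TT part, and the divergence of `h^V` reduces to `□ v_b` because `v` is
divergence-free. -/
theorem IsDecomposition.box_v (hn : n ≠ 0) {h : Tensor2 n} {w : SmoothPC n} {v : Covector n}
    {hTT : Tensor2 n} (H : IsDecomposition h w v hTT) (b : Fin n) :
    box (v b) = divTensor h b - (1 / (n : ℝ)) • pd b (trace h)
      - (((n : ℝ) - 1) / n) • pd b (box w) := by
  have e := congrFun (congrArg divTensor H.sum_eq) b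
  rw [divTensor_add, divTensor_add, Pi.add_apply, Pi.add_apply, divTensor_scalarPart hn,
    divTensor_vectorPart, H.div_v, H.div_hTT, map_zero, Pi.zero_apply] at e
  rw [e]
  abel

theorem divCovector_source (X Y : SmoothPC n) (u : Covector n) (c d : ℝ) :
    divCovector (fun b => u b - c • pd b X - d • pd b Y)
      = divCovector u - c • box X - d • box Y := by
  have : (fun b => u b - c • pd b X - d • pd b Y)
      = u + (-c) • (fun b => pd b X) + (-d) • fun b => pd b Y := by
    ext1 b
    simp only [Pi.add_apply, Pi.smul_apply]
    module
  rw [this, divCovector_add, divCovector_add, divCovector_smul, divCovector_smul, divCovector_pd,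
    divCovector_pd]
  module

/-- Taking the divergence of the equation for `□ v_b` eliminates `v`; the coefficient `(n - 1) / n`
of `□□w` is invertible because `n ≥ 2`. -/
theorem IsDecomposition.box_box_w (hn : 2 ≤ n) {h : Tensor2 n} {w : SmoothPC n} {v : Covector n}
    {hTT : Tensor2 n} (H : IsDecomposition h w v hTT) :
    box (box w) = ((n : ℝ) / ((n : ℝ) - 1)) •
      (divCovector (divTensor h) - (1 / (n : ℝ)) • box (trace h)) := by
  have hn0 : (n : ℝ) ≠ 0 := Nat.cast_ne_zero.2 (by omega)
  have hn1 : (n : ℝ) - 1 ≠ 0 := by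
    rw [sub_ne_zero]
    exact_mod_cast (by omega : n ≠ 1)
  have e := box_divCovector v
  simp only [H.div_v, map_zero, H.box_v (by omega : n ≠ 0), divCovector_source] at e
  rw [sub_eq_zero.1 e.symm, smul_smul, div_mul_div_cancel₀ hn1, div_self hn0, one_smul]

/-- Existence, uniqueness and explicit form of the decomposition, given a retarded Green
operator. -/
theorem IsRetardedGreenOperator.exists_unique_decomposition (hn : 2 ≤ n)
    {G : SmoothPC n →ₗ[ℝ] SmoothPC n} (hG : IsRetardedGreenOperator G) {h : Tensor2 n}
    (hs : h.IsSymm) :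
    ∃ (w : SmoothPC n) (v : Covector n) (hTT : Tensor2 n), IsDecomposition h w v hTT ∧
      (∀ (w' : SmoothPC n) (v' : Covector n) (hTT' : Tensor2 n),
        IsDecomposition h w' v' hTT' → w' = w ∧ v' = v ∧ hTT' = hTT) ∧
      w = ((n : ℝ) / ((n : ℝ) - 1)) •
        G (G (divCovector (divTensor h) - (1 / (n : ℝ)) • box (trace h))) ∧
      ∀ b : Fin n, v b = G (divTensor h b - (1 / (n : ℝ)) • pd b (trace h) -
        (((n : ℝ) - 1) / (n : ℝ)) • pd b (box w)) := by
  have hn0 : (n : ℝ) ≠ 0 := Nat.cast_ne_zero.2 (by omega)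
  have hn1 : (n : ℝ) - 1 ≠ 0 := by
    rw [sub_ne_zero]
    exact_mod_cast (by omega : n ≠ 1)
  set w := ((n : ℝ) / ((n : ℝ) - 1)) •
    G (G (divCovector (divTensor h) - (1 / (n : ℝ)) • box (trace h))) with hw
  set v : Covector n := fun b => G (divTensor h b - (1 / (n : ℝ)) • pd b (trace h) -
    (((n : ℝ) - 1) / (n : ℝ)) • pd b (box w))
  have hbw : box (box w) = ((n : ℝ) / ((n : ℝ) - 1)) •
      (divCovector (divTensor h) - (1 / (n : ℝ)) • box (trace h)) := by
    rw [hw, map_smul, map_smul, hG.box_apply, hG.box_apply]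
  have hbv (b : Fin n) : box (v b) = divTensor h b - (1 / (n : ℝ)) • pd b (trace h) -
      (((n : ℝ) - 1) / (n : ℝ)) • pd b (box w) := hG.box_apply _
  -- By the choice of `w`, the source of `v` is divergence-free, so `□` annihilates the divergence
  -- of `v`.
  have hdv : divCovector v = 0 := by
    apply hG.box_injective
    rw [box_divCovector, map_zero]
    simp only [hbv, divCovector_source]
    rw [hbw, smul_smul, div_mul_div_cancel₀ hn0, div_self hn1, one_smul, sub_self]
  -- The TT part is the remainder; its divergence and trace vanish because the other two parts
  -- already account for those of `h`.
  obtain ⟨k, hk⟩ : ∃ k, h = scalarPart w (trace h) + vectorPart v + k :=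
    ⟨_, (add_sub_cancel _ _).symm⟩
  have hdec : IsDecomposition h w v k := by
    refine ⟨hdv, ?_, ?_, ?_, hk⟩
    · rw [eq_sub_of_add_eq' hk.symm]
      exact hs.sub ((isSymm_scalarPart _ _).add (isSymm_vectorPart _))
    · ext1 b
      have e := congrFun (congrArg divTensor hk) b
      rw [divTensor_add, divTensor_add, Pi.add_apply, Pi.add_apply,
        divTensor_scalarPart (by omega), divTensor_vectorPart, hdv, map_zero, add_zero, hbv] at e
      rw [Pi.zero_apply]
      refine left_eq_add.1 (e.trans (congrArg (· + divTensor k b) ?_))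
      abel
    · have e := congrArg trace hk
      rwa [trace_add, trace_add, trace_scalarPart (by omega), trace_vectorPart, hdv, smul_zero,
        add_zero, left_eq_add] at e
  refine ⟨w, v, k, hdec, fun w' v' k' H => ?_, rfl, fun b => rfl⟩
  -- The scalar is identified first, since the equation for `v` contains `w`.
  obtain rfl : w' = w := hG.box_injective (hG.box_injective (by rw [H.box_box_w hn, hbw]))
  obtain rfl : v' = v := funext fun b => hG.box_injective (by rw [H.box_v (by omega), hbv])
  exact ⟨rfl, rfl, add_left_cancel (H.sum_eq.symm.trans hk)⟩

theorem IsRetardedGreenOperator.unique {G G' : SmoothPC n →ₗ[ℝ] SmoothPC n}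
    (hG : IsRetardedGreenOperator G) (hG' : IsRetardedGreenOperator G') : G' = G :=
  LinearMap.ext fun f => hG.box_injective ((hG'.box_apply f).trans (hG.box_apply f).symm)

/-! ### Existence of the Green operator and conclusion -/

/-- With `R` the Riesz convolution, `R □^{m+1} = c` and `R` commutes with `□`, so `c⁻¹ □^m R`
inverts `□` on both sides. Applying `□^m` does not enlarge supports, and `R` already maps into the
causal future. -/
theorem exists_isRetardedGreenOperator (m : ℕ) :
    ∃ G : SmoothPC (m + 1) →ₗ[ℝ] SmoothPC (m + 1), IsRetardedGreenOperator G := by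
  set c : ℝ := (-1) ^ (m + 1) * rieszLaplace (timeVec m)
  have hc : c ≠ 0 := mul_ne_zero (by simp) rieszLaplace_timeVec_pos.ne'
  have hbox (f : SmoothPC (m + 1)) : c⁻¹ • rieszOp m ((box ^ (m + 1)) f) = f := by
    rw [rieszOp_box_pow, smul_smul, inv_mul_cancel₀ hc, one_smul]
  refine ⟨c⁻¹ • ((box ^ m) ∘ₗ rieszOp m), fun f => ?_, fun f => ?_, fun f => ?_⟩
  · rw [LinearMap.smul_apply, map_smul, LinearMap.comp_apply, ← Module.End.mul_apply, ← pow_succ',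
      box_pow_rieszOp, hbox]
  · rw [LinearMap.smul_apply, LinearMap.comp_apply, box_pow_rieszOp]
    exact hbox f
  · exact (tsupport_smul_subset_right (fun _ => c⁻¹) _).trans
      ((tsupport_box_pow_subset m _).trans (tsupport_rieszConv_subset f))

end Minkowski
end

theorem mainTheorem5 (n : ℕ) (hn : 2 ≤ n) :
    ∃ G : Minkowski.SmoothPC n →ₗ[ℝ] Minkowski.SmoothPC n,
      Minkowski.IsRetardedGreenOperator G ∧
      (∀ G' : Minkowski.SmoothPC n →ₗ[ℝ] Minkowski.SmoothPC n,
        Minkowski.IsRetardedGreenOperator G' → G' = G) ∧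
      ∀ h : Minkowski.Tensor2 n, h.IsSymm →
        ∃ (w : Minkowski.SmoothPC n) (v : Minkowski.Covector n) (hTT : Minkowski.Tensor2 n),
          Minkowski.IsDecomposition h w v hTT ∧
          (∀ (w' : Minkowski.SmoothPC n) (v' : Minkowski.Covector n) (hTT' : Minkowski.Tensor2 n),
            Minkowski.IsDecomposition h w' v' hTT' → w' = w ∧ v' = v ∧ hTT' = hTT) ∧
          w = ((n : ℝ) / ((n : ℝ) - 1)) •
            G (G (Minkowski.divCovector (Minkowski.divTensor h) -
              (1 / (n : ℝ)) • Minkowski.box (Minkowski.trace h))) ∧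
          ∀ b : Fin n, v b =
            G (Minkowski.divTensor h b - (1 / (n : ℝ)) • Minkowski.pd b (Minkowski.trace h) -
              (((n : ℝ) - 1) / (n : ℝ)) • Minkowski.pd b (Minkowski.box w)) := by
  obtain ⟨G, hG⟩ : ∃ G : Minkowski.SmoothPC n →ₗ[ℝ] Minkowski.SmoothPC n,
      Minkowski.IsRetardedGreenOperator G := by
    obtain ⟨m, rfl⟩ : ∃ m, n = m + 1 := ⟨n - 1, by omega⟩
    exact Minkowski.exists_isRetardedGreenOperator m
  exact ⟨G, hG, fun G' hG' => hG.unique hG', fun h hs => hG.exists_unique_decomposition hn hs⟩
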